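/- Let $n\ge 0$. Let $\mathcal S(\mathbb Z^n)$ be the space of functions $g:\mathbb Z^n\to\mathbb C$ with $p_j(g)=\sup_k(1+|k|)^j|g(k)|<\infty$ for all $j\in\mathbb N_0$, with the topology of the seminorms $p_j$, and let $\mathcal S'(\mathbb Z^n)$ be the space of its continuous linear functionals. For $g\in\mathcal S(\mathbb Z^n)$ and $f\in\mathcal S'(\mathbb Z^n)$, the short-time Fourier transform is the function on $\mathbb Z^n\times\mathbb T^n$ $$V_gf(m,w)=\langle f,M_wT_mg\rangle=\sum_{k\in\mathbb Z^n}f(k)\,\overline{g(k-m)}\,e^{-2\pi i w\cdot k}.$$ A Young function is a convex function $\Phi:[0,\infty]\to[0,\infty]$ with $\Phi(0)=0$ and $\lim_{t\to\infty}\Phi(t)=\Phi(\infty)=\infty$; its complementary function is $\Psi(y)=\sup\{x|y|-\Phi(x):x\ge 0\}\in[0,\infty]$. If $\Psi$ is a Young function as well, $(\Phi,\Psi)$ is called a complementary Young pair. $\Phi$ satisfies a local $\Delta_2$-condition if there are $r,C>0$ with $\Phi(2x)\le C\,\Phi(x)$ for all $x\in[0,r]$. Continuity refers to the topology of $[0,\infty]$,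 and strict convexity to the set where the function is finite. For a measure $\mu$ and a measurable function $F$ put $$\|F\|_{L^\Phi(\mu)}=\inf\Big\{b>0:\int\Phi(|F|/b)\,d\mu\le 1\Big\}\in[0,\infty].$$ Take the counting measure on $\mathbb Z^n$, the normalized Haar measure on $\mathbb T^n$ and the product measure on $\mathbb Z^n\times\mathbb T^n$; let $\|F\|_{L^{\Phi}(\mathbb Z^n\times\mathbb T^n)}$ be the norm just defined, and let $\|F\|_{L^{\Phi_1,\Phi_2}(\mathbb Z^n\times\mathbb T^n)}$ be the $L^{\Phi_2}(\mathbb T^n)$ norm of $w\mapsto\|F(\cdot,w)\|_{\ell^{\Phi_1}(\mathbb Z^n)}$. For a window $g\in\mathcal S(\mathbb Z^n)\setminus\{0\}$, the spaces $M^\Phi(\mathbb Z^n)$ and $M^{\Phi_1,\Phi_2}(\mathbb Z^n)$ consist of all $f\in\mathcal S'(\mathbb Z^n)$ for which the norm $\|V_gf\|_{L^{\Phi}(\mathbb Z^n\times\mathbb T^n)}$, respectively $\|V_gf\|_{L^{\Phi_1,\Phi_2}(\mathbb Z^n\times\mathbb T^n)}$, is finite. **Theorem.** (1) Let $\Phi$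 be a Young function that satisfies a local $\Delta_2$-condition and whose complementary function $\Psi$ is continuous. Then $M^\Phi(\mathbb Z^n)$ is independent of the window: any two non-zero windows in $\mathcal S(\mathbb Z^n)$ define the same set with equivalent norms. With the norm of any non-zero window, $M^\Phi(\mathbb Z^n)$ is a Banach space. (2) Let $(\Phi_i,\Psi_i)$, $i=1,2$, be complementary Young pairs such that $\Phi_i$ satisfies a local $\Delta_2$-condition, is strictly convex and is continuous. Then $M^{\Phi_1,\Phi_2}(\mathbb Z^n)$ is independent of the window in the same sense, and with the norm of any non-zero window it is a Banach space. -/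

import Mathlib

open MeasureTheory Filter Topology
open scoped NNReal ENNReal ComplexConjugate

noncomputable section

/-! ### Schwartz space and tempered distributions on the lattice -/

/-- The rapidly decreasing functions on `ℤⁿ`, as a linear subspace of all functions `ℤⁿ → ℂ`.
Here `‖k‖` is the maximum norm of `k`; any other norm gives the same functions. -/
def rapidlyDecreasing (n : ℕ) : Submodule ℂ ((Fin n → ℤ) → ℂ) where
  carrier := {g | ∀ j : ℕ, ∃ C : ℝ, ∀ k, (1 + ‖k‖) ^ j * ‖g k‖ ≤ C}
  zero_mem' := fun _ => ⟨0, fun k => by simp⟩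
  add_mem' := by
    intro a b ha hb j
    obtain ⟨A, hA⟩ := ha j
    obtain ⟨B, hB⟩ := hb j
    refine ⟨A + B, fun k => ?_⟩
    calc (1 + ‖k‖) ^ j * ‖(a + b) k‖ ≤ (1 + ‖k‖) ^ j * (‖a k‖ + ‖b k‖) := by
          gcongr; exact norm_add_le _ _
      _ ≤ A + B := by rw [mul_add]; exact add_le_add (hA k) (hB k)
  smul_mem' := by
    intro c a ha j
    obtain ⟨A, hA⟩ := ha j
    refine ⟨‖c‖ * A, fun k => ?_⟩
    calc (1 + ‖k‖) ^ j * ‖(c • a) k‖ = ‖c‖ * ((1 + ‖k‖) ^ j * ‖a k‖) := by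
          simp; ring
      _ ≤ ‖c‖ * A := by gcongr; exact hA k

/-- The Schwartz space `𝒮(ℤⁿ)`. It is a type of its own, so that it carries the topology of the
Schwartz seminorms and not the one of pointwise convergence. -/
def SchwartzZ (n : ℕ) : Type := rapidlyDecreasing n

namespace SchwartzZ

variable {n : ℕ}

instance : AddCommGroup (SchwartzZ n) := inferInstanceAs (AddCommGroup (rapidlyDecreasing n))

instance : Module ℂ (SchwartzZ n) := inferInstanceAs (Module ℂ (rapidlyDecreasing n))

instance : CoeFun (SchwartzZ n) (fun _ => (Fin n → ℤ) → ℂ) := ⟨fun g => g.1⟩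

theorem decay (g : SchwartzZ n) (j : ℕ) : ∃ C : ℝ, ∀ k, (1 + ‖k‖) ^ j * ‖g k‖ ≤ C := g.2 j

theorem bddAbove_weighted (g : SchwartzZ n) (j : ℕ) :
    BddAbove (Set.range fun k => (1 + ‖k‖) ^ j * ‖g k‖) := by
  obtain ⟨C, hC⟩ := g.decay j
  exact ⟨C, by rintro _ ⟨k, rfl⟩; exact hC k⟩

/-- The seminorm `p_j(g) = sup_k (1 + |k|)^j |g(k)|`. -/
def seminorm (n j : ℕ) : Seminorm ℂ (SchwartzZ n) :=
  Seminorm.of (fun g => ⨆ k, (1 + ‖k‖) ^ j * ‖g k‖)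
    (by
      intro f g
      refine ciSup_le fun k => ?_
      calc (1 + ‖k‖) ^ j * ‖f k + g k‖ ≤ (1 + ‖k‖) ^ j * (‖f k‖ + ‖g k‖) := by
            gcongr; exact norm_add_le _ _
        _ ≤ _ := by
            rw [mul_add]
            exact add_le_add (le_ciSup (f.bddAbove_weighted j) k)
              (le_ciSup (g.bddAbove_weighted j) k))
    (by
      intro c g
      rw [Real.mul_iSup_of_nonneg (norm_nonneg c)]
      refine iSup_congr fun k => ?_
      change (1 + ‖k‖) ^ j * ‖c * g k‖ = _
      rw [norm_mul]; ring)

/-- The topology of `𝒮(ℤⁿ)` is the one induced by the seminorms `p_j`. -/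
instance : TopologicalSpace (SchwartzZ n) :=
  SeminormFamily.moduleFilterBasis (𝕜 := ℂ) (seminorm n) |>.topology'

/-- Translation `T_m g (k) = g (k - m)`. -/
def translate (m : Fin n → ℤ) (g : SchwartzZ n) : SchwartzZ n :=
  ⟨fun k => g (k - m), by
    intro j
    obtain ⟨C, hC⟩ := g.decay j
    refine ⟨(1 + ‖m‖) ^ j * C, fun k => ?_⟩
    have h : 1 + ‖k‖ ≤ (1 + ‖m‖) * (1 + ‖k - m‖) := by
      have h1 : ‖k‖ ≤ ‖k - m‖ + ‖m‖ := by simpa using norm_add_le (k - m) m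
      nlinarith [mul_nonneg (norm_nonneg m) (norm_nonneg (k - m))]
    calc (1 + ‖k‖) ^ j * ‖g (k - m)‖
        ≤ ((1 + ‖m‖) * (1 + ‖k - m‖)) ^ j * ‖g (k - m)‖ := by gcongr
      _ = (1 + ‖m‖) ^ j * ((1 + ‖k - m‖) ^ j * ‖g (k - m)‖) := by rw [mul_pow]; ring
      _ ≤ (1 + ‖m‖) ^ j * C := by gcongr; exact hC _⟩

/-- Modulation `M_w g (k) = e^{2 π i w ⬝ k} g k`, for `w` in the torus `𝕋ⁿ = (ℝ/ℤ)ⁿ`. -/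
def modulate (w : UnitAddTorus (Fin n)) (g : SchwartzZ n) : SchwartzZ n :=
  ⟨fun k => UnitAddTorus.mFourier k w * g k, by
    intro j
    obtain ⟨C, hC⟩ := g.decay j
    refine ⟨C, fun k => le_trans ?_ (hC k)⟩
    gcongr
    rw [norm_mul]
    have h := (UnitAddTorus.mFourier k).norm_coe_le_norm w
    rw [UnitAddTorus.mFourier_norm] at h
    exact mul_le_of_le_one_left (norm_nonneg _) h⟩

/-- Pointwise complex conjugation. -/
def conjugate (g : SchwartzZ n) : SchwartzZ n :=
  ⟨fun k => conj (g k), by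
    intro j
    obtain ⟨C, hC⟩ := g.decay j
    exact ⟨C, fun k => by simpa using hC k⟩⟩

end SchwartzZ

/-- The tempered distributions `𝒮'(ℤⁿ)`: the continuous linear functionals on `𝒮(ℤⁿ)`. -/
abbrev TemperedZ (n : ℕ) : Type := SchwartzZ n →L[ℂ] ℂ

/-- The short-time Fourier transform `V_g f (m, w) = ⟨f, M_w T_m g⟩`. The bracket is conjugate
linear in the second entry, so the functional `f` is applied to the conjugate of `M_w T_m g`;
for a function `f` this is `∑ₖ f(k) conj (g(k - m)) e^{-2 π i w ⬝ k}`. -/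
def stft {n : ℕ} (g : SchwartzZ n) (f : TemperedZ n) (m : Fin n → ℤ)
    (w : UnitAddTorus (Fin n)) : ℂ :=
  f ((g.translate m).modulate w).conjugate

/-! ### Young functions -/

/-- A Young function `Φ : [0, ∞] → [0, ∞]`. -/
structure IsYoungFunction (Φ : ℝ≥0∞ → ℝ≥0∞) : Prop where
  convex : ConvexOn ℝ≥0 Set.univ Φ
  map_zero : Φ 0 = 0
  map_top : Φ ∞ = ∞
  tendsto : Tendsto (fun t : ℝ≥0 => Φ t) atTop (𝓝 ∞)

/-- The complementary function `Ψ(y) = sup {x y - Φ(x) : x ≥ 0}`. The truncated subtraction of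
`[0, ∞]` does not change the supremum, since `x = 0` contributes `0`. Only `y ≥ 0` is kept of
the even function `y ↦ sup {x |y| - Φ(x) : x ≥ 0}` on the line. -/
def complementaryFunction (Φ : ℝ≥0∞ → ℝ≥0∞) (y : ℝ≥0∞) : ℝ≥0∞ :=
  ⨆ x : ℝ≥0, (x * y - Φ x)

/-- `(Φ, Ψ)` is a complementary pair of Young functions. -/
structure IsComplementaryYoungPair (Φ Ψ : ℝ≥0∞ → ℝ≥0∞) : Prop where
  left : IsYoungFunction Φ
  right : IsYoungFunction Ψ
  eq_complementary : Ψ = complementaryFunction Φ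

/-- The local `Δ₂`-condition: `Φ(2x) ≤ C Φ(x)` for all `x` in some interval `[0, r]`. -/
def LocalDeltaTwo (Φ : ℝ≥0∞ → ℝ≥0∞) : Prop :=
  ∃ r C : ℝ≥0, 0 < r ∧ 0 < C ∧ ∀ x : ℝ≥0, x ≤ r → Φ (2 * x) ≤ C * Φ x

/-- Strict convexity of `Φ` on the interval where it is finite. For a finite-valued Young
function this is strict convexity on `[0, ∞)`. -/
def IsStrictlyConvex (Φ : ℝ≥0∞ → ℝ≥0∞) : Prop :=
  StrictConvexOn ℝ≥0 {x | x ≠ ∞ ∧ Φ x ≠ ∞} Φ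

/-! ### Orlicz norms on `ℤⁿ × 𝕋ⁿ` -/

/-- The Luxemburg functional `inf {b > 0 : ∫ Φ(F / b) dμ ≤ 1}` of a function `F ≥ 0`, equal to
`∞` if there is no such `b`. -/
def luxemburgNorm {α : Type*} [MeasurableSpace α] (Φ : ℝ≥0∞ → ℝ≥0∞) (μ : Measure α)
    (F : α → ℝ≥0∞) : ℝ≥0∞ :=
  ⨅ (b : ℝ≥0) (_ : 0 < b) (_ : ∫⁻ x, Φ (F x / b) ∂μ ≤ 1), (b : ℝ≥0∞)

/-- The normalized Haar measure `dw` on `𝕋ⁿ = (ℝ/ℤ)ⁿ`. -/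
def torusMeasure (n : ℕ) : Measure (UnitAddTorus (Fin n)) :=
  Measure.pi fun _ => AddCircle.haarAddCircle

/-- The norm of `L^Φ(ℤⁿ × 𝕋ⁿ)`, with the counting measure on `ℤⁿ`. -/
def orliczNorm {n : ℕ} (Φ : ℝ≥0∞ → ℝ≥0∞)
    (F : (Fin n → ℤ) → UnitAddTorus (Fin n) → ℂ) : ℝ≥0∞ :=
  luxemburgNorm Φ (Measure.count.prod (torusMeasure n)) fun p => ‖F p.1 p.2‖ₑ

/-- The norm of the mixed space `L^{Φ₁,Φ₂}(ℤⁿ × 𝕋ⁿ)`: the `ℓ^{Φ₁}(ℤⁿ)` norm for fixed `w`, and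
then the `L^{Φ₂}(𝕋ⁿ)` norm in `w`. -/
def mixedOrliczNorm {n : ℕ} (Φ₁ Φ₂ : ℝ≥0∞ → ℝ≥0∞)
    (F : (Fin n → ℤ) → UnitAddTorus (Fin n) → ℂ) : ℝ≥0∞ :=
  luxemburgNorm Φ₂ (torusMeasure n) fun w =>
    luxemburgNorm Φ₁ Measure.count fun m => ‖F m w‖ₑ

/-! ### Orlicz modulation spaces -/

/-- The norm of `M^Φ(ℤⁿ)` with window `g`, with value `∞` outside the space. -/
def modulationNorm {n : ℕ} (Φ : ℝ≥0∞ → ℝ≥0∞) (g : SchwartzZ n) (f : TemperedZ n) : ℝ≥0∞ :=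
  orliczNorm Φ (stft g f)

/-- The Orlicz modulation space `M^Φ(ℤⁿ)`, defined with the window `g`. -/
def modulationSpace {n : ℕ} (Φ : ℝ≥0∞ → ℝ≥0∞) (g : SchwartzZ n) : Set (TemperedZ n) :=
  {f | modulationNorm Φ g f < ∞}

/-- The norm of `M^{Φ₁,Φ₂}(ℤⁿ)` with window `g`, with value `∞` outside the space. -/
def mixedModulationNorm {n : ℕ} (Φ₁ Φ₂ : ℝ≥0∞ → ℝ≥0∞) (g : SchwartzZ n)
    (f : TemperedZ n) : ℝ≥0∞ :=
  mixedOrliczNorm Φ₁ Φ₂ (stft g f)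

/-- The Orlicz modulation space `M^{Φ₁,Φ₂}(ℤⁿ)`, defined with the window `g`. -/
def mixedModulationSpace {n : ℕ} (Φ₁ Φ₂ : ℝ≥0∞ → ℝ≥0∞) (g : SchwartzZ n) :
    Set (TemperedZ n) :=
  {f | mixedModulationNorm Φ₁ Φ₂ g f < ∞}

/-- `N₁` and `N₂` are equivalent on `X`: each is at most a finite constant times the other. -/
def EquivalentNormsOn {E : Type*} (X : Set E) (N₁ N₂ : E → ℝ≥0∞) : Prop :=
  ∃ A B : ℝ≥0, ∀ f ∈ X, N₁ f ≤ A * N₂ f ∧ N₂ f ≤ B * N₁ f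

/-- `X` is a linear subspace of `E`, `N` is finite on `X`, and with `N` as its norm `X` is a
Banach space: `N` is a norm on `X`, and `X` is complete for the metric of this norm. -/
def IsBanachSpaceOn {E : Type*} [AddCommGroup E] [Module ℂ E] (X : Set E)
    (N : E → ℝ≥0∞) : Prop :=
  ∃ M : Submodule ℂ E, (M : Set E) = X ∧ (∀ f ∈ X, N f < ∞) ∧
    ∃ core : @NormedSpace.Core ℂ M _ _ _ ⟨fun f => (N f).toReal⟩,
      @CompleteSpace M (@NormedAddCommGroup.ofCore ℂ M _ _ _
        ⟨fun f => (N f).toReal⟩ core).toPseudoMetricSpace.toUniformSpace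

end

/-! Both modulation spaces are Orlicz sequence spaces in disguise. A tempered distribution on the
lattice is determined by its values `f (delta k)`, and for every non-zero window the norm of `stft g
f` is comparable with the `ℓ^Φ` Luxemburg norm of `k ↦ f (delta k)` (with `Φ = Φ₁` in the mixed
case).

Upper bound (`exists_le_luxemburgNorm`): `|V_g f(m, w)| ≤ ∑ⱼ |g(j)| |f(m + j)|`. The right side does
not depend on `w` and is a superposition of translates with summable weights, so Minkowski's
inequality bounds it. Lower bound (`exists_luxemburgNorm_le`): `f(k + m) conj (g k)` is a Fourier
coefficient of `V_g f(m, ·)`, hence at most `∫ |V_g f(m, w)| dw`. Fix `k` with `g k ≠ 0`; the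
average over the torus is controlled by Jensen or Minkowski. What these bounds need from the norm is
collected in `IsAdmissibleNorm`.

Window independence follows by passing through `ℓ^Φ`. For completeness, a Cauchy sequence converges
pointwise on the lattice, the limit is tempered because it differs from one term by a bounded
function, and Fatou's lemma gives convergence in norm. -/

noncomputable section

/-! ### Young functions and Jensen's inequality -/

namespace IsYoungFunction

variable {Φ : ℝ≥0∞ → ℝ≥0∞}

theorem map_mul_le (hΦ : IsYoungFunction Φ) {c : ℝ≥0} (hc : c ≤ 1) (x : ℝ≥0∞) :
    Φ (c * x) ≤ c * Φ x := by
  have h := hΦ.convex.2 (Set.mem_univ x) (Set.mem_univ 0) (zero_le (a := c))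
    (zero_le (a := 1 - c)) (add_tsub_cancel_of_le hc)
  simpa [hΦ.map_zero, ENNReal.smul_def] using h

theorem monotone (hΦ : IsYoungFunction Φ) : Monotone Φ := by
  intro x y hxy
  rcases eq_or_ne y ∞ with rfl | hy
  · simp [hΦ.map_top]
  rcases eq_or_ne y 0 with rfl | hy0
  · simp_all
  have hc : x / y ≤ 1 := ENNReal.div_le_of_le_mul (by simpa using hxy)
  have hct : x / y ≠ ∞ := ne_top_of_le_ne_top ENNReal.one_ne_top hc
  have h := hΦ.map_mul_le (c := (x / y).toNNReal)
    (by rw [← ENNReal.coe_le_coe, ENNReal.coe_toNNReal hct]; simpa using hc) y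
  rw [ENNReal.coe_toNNReal hct, ENNReal.div_mul_cancel hy0 hy] at h
  exact h.trans (mul_le_of_le_one_left' hc)

theorem measurable (hΦ : IsYoungFunction Φ) : Measurable Φ := hΦ.monotone.measurable

theorem exists_lt (hΦ : IsYoungFunction Φ) {a : ℝ≥0∞} (ha : a < ∞) :
    ∃ x : ℝ≥0, a < Φ x :=
  (hΦ.tendsto.eventually (lt_mem_nhds ha)).exists

/-- Total weight below one is allowed because the missing mass can be placed at `0`, where `Φ`
vanishes. -/
theorem map_sum_le (hΦ : IsYoungFunction Φ) {ι : Type*} (s : Finset ι) (w : ι → ℝ≥0)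
    (x : ι → ℝ≥0∞) (hw : ∑ i ∈ s, w i ≤ 1) :
    Φ (∑ i ∈ s, w i * x i) ≤ ∑ i ∈ s, w i * Φ (x i) := by
  classical
  induction s using Finset.induction_on generalizing w with
  | empty => simp [hΦ.map_zero]
  | insert a s ha ih =>
    rw [Finset.sum_insert ha] at hw
    rw [Finset.sum_insert ha, Finset.sum_insert ha]
    set c := w a with hc
    -- The induction renormalizes the remaining weights by `1 - c`; if this is zero, those weights
    -- all vanish.
    rcases eq_or_ne (1 - c) 0 with h0 | h0
    · have hc1 : 1 ≤ c := tsub_eq_zero_iff_le.1 h0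
      have hs : ∑ i ∈ s, w i = 0 := by
        refine le_antisymm ?_ zero_le
        have : c + ∑ i ∈ s, w i ≤ c + 0 := by simpa using hw.trans hc1
        exact le_of_add_le_add_left this
      have hz : ∀ i ∈ s, w i = 0 := by simpa [Finset.sum_eq_zero_iff] using hs
      have e1 : ∑ i ∈ s, (w i : ℝ≥0∞) * x i = 0 :=
        Finset.sum_eq_zero fun i hi => by simp [hz i hi]
      have e2 : ∑ i ∈ s, (w i : ℝ≥0∞) * Φ (x i) = 0 :=
        Finset.sum_eq_zero fun i hi => by simp [hz i hi]
      rw [e1, e2, add_zero, add_zero]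
      exact hΦ.map_mul_le ((self_le_add_right _ _).trans hw) _
    · have hc1 : c ≤ 1 := (self_le_add_right _ _).trans hw
      have hs : ∑ i ∈ s, w i / (1 - c) ≤ 1 := by
        rw [← Finset.sum_div]
        refine div_le_one_of_le₀ ?_ zero_le
        exact le_tsub_of_add_le_left hw
      have key : ∀ y : ι → ℝ≥0∞, ∑ i ∈ s, (w i : ℝ≥0∞) * y i =
          (1 - c : ℝ≥0) * ∑ i ∈ s, ((w i / (1 - c) : ℝ≥0) : ℝ≥0∞) * y i := by
        intro y
        rw [Finset.mul_sum]
        refine Finset.sum_congr rfl fun i _ => ?_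
        rw [← mul_assoc, ← ENNReal.coe_mul, mul_div_cancel₀ _ h0]
      rw [key x, key fun i => Φ (x i)]
      have h := hΦ.convex.2 (Set.mem_univ (x a))
        (Set.mem_univ (∑ i ∈ s, ((w i / (1 - c) : ℝ≥0) : ℝ≥0∞) * x i)) (zero_le (a := c))
        (zero_le (a := 1 - c)) (add_tsub_cancel_of_le hc1)
      simp only [ENNReal.smul_def, smul_eq_mul] at h
      refine h.trans ?_
      gcongr
      exact ih _ hs

variable {α : Type*} [MeasurableSpace α] {μ : Measure α}

/-- The strict inequality leaves room for a simple function below `F` whose integral already exceeds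
`x`. Finite Jensen then applies, with the measures of its level sets as weights. -/
theorem map_le_lintegral_of_lt (hΦ : IsYoungFunction Φ) (hμ : μ Set.univ ≤ 1) {F : α → ℝ≥0∞}
    (hF : Measurable F) {x : ℝ≥0∞} (hx : x < ∫⁻ a, F a ∂μ) :
    Φ x ≤ ∫⁻ a, Φ (F a) ∂μ := by
  rw [lintegral_eq_iSup_eapprox_lintegral hF, lt_iSup_iff] at hx
  obtain ⟨k, hk⟩ := hx
  set φ := SimpleFunc.eapprox F k with hφ
  have hfin : ∀ s, μ s ≠ ∞ := fun s =>
    ne_top_of_le_ne_top ENNReal.one_ne_top ((measure_mono (Set.subset_univ s)).trans hμ)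
  have hw : ∑ r ∈ φ.range, (μ (φ ⁻¹' {r})).toNNReal ≤ 1 := by
    rw [← ENNReal.coe_le_coe]
    push_cast
    simp only [ENNReal.coe_toNNReal (hfin _)]
    rwa [φ.sum_range_measure_preimage_singleton]
  have h := hΦ.map_sum_le φ.range (fun r => (μ (φ ⁻¹' {r})).toNNReal) id hw
  simp only [ENNReal.coe_toNNReal (hfin _), id] at h
  calc Φ x ≤ Φ (φ.lintegral μ) := hΦ.monotone hk.le
    _ ≤ (φ.map Φ).lintegral μ := by
      rw [SimpleFunc.map_lintegral, SimpleFunc.lintegral]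
      simpa only [mul_comm] using h
    _ = ∫⁻ a, Φ (φ a) ∂μ := by rw [← SimpleFunc.lintegral_eq_lintegral]; rfl
    _ ≤ ∫⁻ a, Φ (F a) ∂μ := lintegral_mono fun a =>
      hΦ.monotone (by
                      rw [← SimpleFunc.iSup_eapprox_apply hF a]
                      exact le_iSup (fun k => SimpleFunc.eapprox F k a) k)

/-- Jensen's inequality for a Young function, up to a factor `θ < 1` in the argument, which
makes lower semicontinuity of `Φ` unnecessary. -/
theorem map_mul_lintegral_le (hΦ : IsYoungFunction Φ) (hμ : μ Set.univ ≤ 1) {F : α → ℝ≥0∞}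
    (hF : Measurable F) {θ : ℝ≥0} (hθ : θ < 1) :
    Φ (θ * ∫⁻ a, F a ∂μ) ≤ ∫⁻ a, Φ (F a) ∂μ := by
  rcases eq_or_ne (∫⁻ a, F a ∂μ) 0 with h0 | h0
  · simp [h0, hΦ.map_zero]
  rcases eq_or_ne (∫⁻ a, F a ∂μ) ∞ with ht | ht
  · have : ∫⁻ a, Φ (F a) ∂μ = ∞ := by
      refine top_le_iff.1 (le_of_tendsto' hΦ.tendsto fun t => ?_)
      exact hΦ.map_le_lintegral_of_lt hμ hF (by simp [ht])
    simp [this]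
  · refine hΦ.map_le_lintegral_of_lt hμ hF ?_
    conv_rhs => rw [← one_mul (∫⁻ a, F a ∂μ)]
    exact (ENNReal.mul_lt_mul_iff_left h0 ht).2 (by exact_mod_cast hθ)

end IsYoungFunction

/-! ### The Luxemburg norm -/

section Luxemburg

variable {Φ : ℝ≥0∞ → ℝ≥0∞} {α : Type*} [MeasurableSpace α] {μ : Measure α}

theorem luxemburgNorm_le {F : α → ℝ≥0∞} {b : ℝ≥0} (hb : 0 < b)
    (h : ∫⁻ x, Φ (F x / b) ∂μ ≤ 1) : luxemburgNorm Φ μ F ≤ b :=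
  iInf_le_of_le b (iInf_le_of_le hb (iInf_le_of_le h le_rfl))

theorem lintegral_le_one_of_luxemburgNorm_lt (hΦ : IsYoungFunction Φ) {F : α → ℝ≥0∞} {b : ℝ≥0∞}
    (h : luxemburgNorm Φ μ F < b) : ∫⁻ x, Φ (F x / b) ∂μ ≤ 1 := by
  simp only [luxemburgNorm, iInf_lt_iff] at h
  obtain ⟨c, hc, hi, hcb⟩ := h
  refine le_trans (lintegral_mono fun x => hΦ.monotone ?_) hi
  exact ENNReal.div_le_div_left hcb.le _

/-- To bound the Luxemburg norm by `c`, it suffices to treat every larger finite bound. -/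
theorem luxemburgNorm_le_of_forall_lt {F : α → ℝ≥0∞} {c : ℝ≥0∞}
    (h : ∀ b : ℝ≥0, c < b → ∫⁻ x, Φ (F x / b) ∂μ ≤ 1) : luxemburgNorm Φ μ F ≤ c := by
  refine le_of_forall_gt_imp_ge_of_dense fun a ha => ?_
  obtain ⟨b, hcb, hba⟩ := ENNReal.lt_iff_exists_nnreal_btwn.1 ha
  exact (luxemburgNorm_le (by exact_mod_cast (zero_le (a := c)).trans_lt hcb) (h b hcb)).trans hba.le

theorem luxemburgNorm_mono (hΦ : IsYoungFunction Φ) {F G : α → ℝ≥0∞} (h : ∀ x, F x ≤ G x) :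
    luxemburgNorm Φ μ F ≤ luxemburgNorm Φ μ G :=
  luxemburgNorm_le_of_forall_lt fun _ hb =>
    (lintegral_mono fun x => hΦ.monotone (ENNReal.div_le_div_right (h x) _)).trans
      (lintegral_le_one_of_luxemburgNorm_lt hΦ hb)

theorem luxemburgNorm_const_mul_le (hΦ : IsYoungFunction Φ) (c : ℝ≥0) (F : α → ℝ≥0∞) :
    luxemburgNorm Φ μ (fun x => c * F x) ≤ c * luxemburgNorm Φ μ F := by
  rcases eq_or_ne c 0 with rfl | hc
  · exact luxemburgNorm_le_of_forall_lt fun _ _ => by simp [hΦ.map_zero]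
  refine luxemburgNorm_le_of_forall_lt fun b hb => ?_
  have hc' : (c : ℝ≥0∞) ≠ 0 := by simpa using hc
  have h : luxemburgNorm Φ μ F < b / c :=
    (ENNReal.lt_div_iff_mul_lt (.inl hc') (.inl ENNReal.coe_ne_top)).2 (by rwa [mul_comm])
  refine le_trans (lintegral_mono fun x => hΦ.monotone ?_)
    (lintegral_le_one_of_luxemburgNorm_lt hΦ h)
  rw [ENNReal.div_eq_inv_mul, ENNReal.div_eq_inv_mul (a := F x),
    ENNReal.inv_div (.inl ENNReal.coe_ne_top) (.inl hc'), div_eq_mul_inv]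
  exact le_of_eq (by ring)

/-- Fatou's lemma for the Luxemburg norm. -/
theorem luxemburgNorm_liminf_le (hΦ : IsYoungFunction Φ) {F : ℕ → α → ℝ≥0∞}
    (hF : ∀ l, Measurable (F l)) :
    luxemburgNorm Φ μ (fun x => liminf (fun l => F l x) atTop) ≤
      liminf (fun l => luxemburgNorm Φ μ (F l)) atTop := by
  refine luxemburgNorm_le_of_forall_lt fun b hb => ?_
  -- The gap between `c` and `b` replaces lower semicontinuity of `Φ`: when `y` is positive and
  -- finite, `y / b < y / c`, so eventually or in the limit only monotonicity is needed.
  obtain ⟨c, hc, hcb⟩ := ENNReal.lt_iff_exists_nnreal_btwn.1 hb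
  have hc0 : 0 < c := by exact_mod_cast zero_le.trans_lt hc
  have hfreq := frequently_lt_of_liminf_lt (by isBoundedDefault) hc
  have hpt : ∀ x, Φ (liminf (fun l => F l x) atTop / b) ≤
      liminf (fun l => Φ (F l x / c)) atTop := by
    intro x
    set y := liminf (fun l => F l x) atTop with hy
    have hlt : ∀ t : ℝ≥0∞, t < y / c → Φ t ≤ liminf (fun l => Φ (F l x / c)) atTop := by
      intro t ht
      have ht' : t * c < y := (ENNReal.lt_div_iff_mul_lt (by simp [hc0.ne']) (by simp)).1 ht
      refine le_liminf_of_le (by isBoundedDefault) ?_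
      filter_upwards [eventually_lt_of_lt_liminf ht'] with l hl
      exact hΦ.monotone
        ((ENNReal.le_div_iff_mul_le (by simp [hc0.ne']) (by simp)).2 hl.le)
    rcases eq_or_ne y 0 with h0 | h0
    · simp [h0, hΦ.map_zero]
    rcases eq_or_ne y ∞ with ht | ht
    · refine le_trans le_top (le_of_tendsto' hΦ.tendsto fun t => hlt t ?_)
      simp [ht, ENNReal.top_div]
    · exact hlt _ (ENNReal.div_lt_div_left h0 ht hcb)
  have hm : ∀ l, Measurable fun x => Φ (F l x / c) := fun l =>
    hΦ.measurable.comp ((hF l).div_const _)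
  refine ((lintegral_mono hpt).trans (lintegral_liminf_le hm)).trans ?_
  refine liminf_le_of_frequently_le (hfreq.mono fun l hl => ?_) (by isBoundedDefault)
  exact lintegral_le_one_of_luxemburgNorm_lt hΦ hl

/-- Every bound above the infimum is admissible, so a strict sublevel set is a countable union over
rational bounds, each piece being given by a measurable integral. -/
theorem measurable_luxemburgNorm (hΦ : IsYoungFunction Φ) {β : Type*} [MeasurableSpace β]
    [SFinite μ] {F : α → β → ℝ≥0∞} (hF : Measurable (Function.uncurry F)) :
    Measurable fun s => luxemburgNorm Φ μ fun a => F a s := by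
  refine measurable_of_Iio fun c => ?_
  have : (fun s => luxemburgNorm Φ μ fun a => F a s) ⁻¹' Set.Iio c =
      ⋃ q : {q : ℚ≥0 // ((q : ℝ≥0) : ℝ≥0∞) < c},
        {s | 0 < q.1 ∧ ∫⁻ a, Φ (F a s / ((q.1 : ℝ≥0) : ℝ≥0∞)) ∂μ ≤ 1} := by
    ext s
    simp only [Set.mem_preimage, Set.mem_Iio, Set.mem_iUnion, Set.mem_ofPred_eq]
    constructor
    · intro h
      obtain ⟨q, hq0, hq1, hq2⟩ := ENNReal.lt_iff_exists_rat_btwn.1 h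
      lift q to ℚ≥0 using hq0
      have e : Real.toNNReal ((q : ℚ) : ℝ) = (q : ℝ≥0) := by
        ext
        rw [Real.coe_toNNReal _ (by exact_mod_cast q.2)]
        push_cast
        rfl
      rw [e] at hq1 hq2
      refine ⟨⟨q, hq2⟩, ?_, lintegral_le_one_of_luxemburgNorm_lt hΦ hq1⟩
      have : 0 < (q : ℝ≥0) := by exact_mod_cast zero_le.trans_lt hq1
      exact_mod_cast this
    · rintro ⟨⟨q, hq⟩, h0, hi⟩
      exact (luxemburgNorm_le (by exact_mod_cast h0) hi).trans_lt hq
  rw [this]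
  refine MeasurableSet.iUnion fun q => ?_
  have hm : Measurable fun s => ∫⁻ a, Φ (F a s / ((q.1 : ℝ≥0) : ℝ≥0∞)) ∂μ :=
    Measurable.lintegral_prod_left' (f := fun p : α × β => Φ (F p.1 p.2 / ((q.1 : ℝ≥0) : ℝ≥0∞)))
      (hΦ.measurable.comp (hF.div_const _))
  exact (MeasurableSet.const _).inter (hm measurableSet_Iic)

/-- Minkowski's integral inequality for the Luxemburg norm. -/
theorem luxemburgNorm_lintegral_le (hΦ : IsYoungFunction Φ) {β : Type*} [MeasurableSpace β]
    [SFinite μ] {ρ : Measure β} [IsFiniteMeasure ρ] {F : α → β → ℝ≥0∞}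
    (hF : Measurable (Function.uncurry F)) :
    luxemburgNorm Φ μ (fun a => ∫⁻ s, F a s ∂ρ) ≤
      ∫⁻ s, luxemburgNorm Φ μ (fun a => F a s) ∂ρ := by
  refine luxemburgNorm_le_of_forall_lt fun c hc => ?_
  set N : β → ℝ≥0∞ := fun s => luxemburgNorm Φ μ fun a => F a s with hN
  have hNm : Measurable N := measurable_luxemburgNorm hΦ hF
  obtain ⟨d, hd, hdc⟩ := ENNReal.lt_iff_exists_nnreal_btwn.1 hc
  have hd0 : 0 < d := by exact_mod_cast zero_le.trans_lt hd
  have hd0' : (d : ℝ≥0∞) ≠ 0 := by simpa using hd0.ne'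
  have hc0 : 0 < c := hd0.trans (by exact_mod_cast hdc)
  -- Adding `ε` makes the density `q` positive and strictly larger than `N` where `N` is finite,
  -- while its total integral stays at most `d`.
  obtain ⟨ε, hε, hερ⟩ := ENNReal.exists_nnreal_pos_mul_lt (measure_ne_top ρ Set.univ)
    (tsub_pos_of_lt hd).ne'
  set q : β → ℝ≥0∞ := fun s => N s + ε with hq
  have hqm : Measurable q := hNm.add_const _
  have hqd : ∫⁻ s, q s ∂ρ ≤ d := by
    rw [hq, lintegral_add_right _ measurable_const, lintegral_const]
    exact (add_le_add_right hερ.le _).trans_eq (add_tsub_cancel_of_le hd.le)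
  have hfin : ∀ᵐ s ∂ρ, N s < ∞ := ae_lt_top hNm hd.ne_top
  -- Change of measure: `ν` has mass at most one and `(∫ F dρ) / d = ∫ (F / q) dν`. Jensen applies
  -- to this average, and `q > N` bounds the modular of each slice `F(·, s) / q(s)` by one.
  set ν := ρ.withDensity fun s => q s / d with hν
  have hνm : Measurable fun s => q s / d := hqm.div_const _
  have hν1 : ν Set.univ ≤ 1 := by
    rw [hν, withDensity_apply _ MeasurableSet.univ, Measure.restrict_univ]
    simp only [div_eq_mul_inv]
    rw [lintegral_mul_const _ hqm, ← div_eq_mul_inv]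
    exact ENNReal.div_le_of_le_mul (by simpa using hqd)
  have : IsFiniteMeasure ν := ⟨hν1.trans_lt ENNReal.one_lt_top⟩
  have hFq : Measurable fun p : α × β => F p.1 p.2 / q p.2 :=
    hF.div (hqm.comp measurable_snd)
  have hFs : ∀ a, Measurable fun s => F a s / q s := fun a => hFq.comp measurable_prodMk_left
  have hint : ∀ a, ∫⁻ s, F a s / q s ∂ν = (∫⁻ s, F a s ∂ρ) / d := by
    intro a
    rw [hν, lintegral_withDensity_eq_lintegral_mul _ hνm (hFs a), div_eq_mul_inv,
      ← lintegral_mul_const _ (show Measurable fun s => F a s from hF.comp measurable_prodMk_left)]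
    refine lintegral_congr_ae ?_
    filter_upwards [hfin] with s hs
    have h0 : q s ≠ 0 := by simp [hq, hε.ne']
    have ht : q s ≠ ∞ := by simp [hq, hs.ne]
    simp only [Pi.mul_apply, div_eq_mul_inv]
    calc q s * (d : ℝ≥0∞)⁻¹ * (F a s * (q s)⁻¹) = q s * (q s)⁻¹ * (F a s * (d : ℝ≥0∞)⁻¹) := by
          ring
      _ = _ := by rw [ENNReal.mul_inv_cancel h0 ht, one_mul]
  have hθ : d / c < 1 := by
    rw [div_lt_one hc0]; exact_mod_cast hdc
  calc ∫⁻ a, Φ ((∫⁻ s, F a s ∂ρ) / c) ∂μ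
      ≤ ∫⁻ a, ∫⁻ s, Φ (F a s / q s) ∂ν ∂μ := by
        refine lintegral_mono fun a => ?_
        have h := hΦ.map_mul_lintegral_le hν1 (hFs a) hθ
        rw [hint a] at h
        refine le_trans (le_of_eq (congrArg Φ ?_)) h
        rw [ENNReal.coe_div hc0.ne']
        simp only [div_eq_mul_inv]
        calc (∫⁻ s, F a s ∂ρ) * (c : ℝ≥0∞)⁻¹
            = ((d : ℝ≥0∞) * (d : ℝ≥0∞)⁻¹) * ((∫⁻ s, F a s ∂ρ) * (c : ℝ≥0∞)⁻¹) := by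
              rw [ENNReal.mul_inv_cancel hd0' ENNReal.coe_ne_top, one_mul]
          _ = _ := by ring
    _ = ∫⁻ s, ∫⁻ a, Φ (F a s / q s) ∂μ ∂ν :=
        lintegral_lintegral_swap (hΦ.measurable.comp hFq).aemeasurable
    _ ≤ ∫⁻ _, 1 ∂ν := by
        refine lintegral_mono_ae ?_
        filter_upwards [(withDensity_absolutelyContinuous ρ _).ae_le hfin] with s hs
        refine lintegral_le_one_of_luxemburgNorm_lt hΦ ?_
        exact ENNReal.lt_add_right hs.ne (by simpa using hε.ne')
    _ ≤ 1 := by simpa using hν1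

/-- This is Minkowski's integral inequality over a two-point space. -/
theorem luxemburgNorm_add_le (hΦ : IsYoungFunction Φ) [SFinite μ] {F G : α → ℝ≥0∞}
    (hF : Measurable F) (hG : Measurable G) :
    luxemburgNorm Φ μ (fun x => F x + G x) ≤ luxemburgNorm Φ μ F + luxemburgNorm Φ μ G := by
  have hm : Measurable (Function.uncurry fun (a : α) (s : Bool) => cond s (F a) (G a)) :=
    measurable_from_prod_countable_left fun s => by cases s <;> simpa
  simpa [lintegral_count, tsum_fintype] using
    luxemburgNorm_lintegral_le (μ := μ) (ρ := Measure.count) hΦ hm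

theorem luxemburgNorm_count_add_right {G : Type*} [AddGroup G]
    [MeasurableSpace G] [MeasurableSingletonClass G] (A : G → ℝ≥0∞) (j : G) :
    luxemburgNorm Φ Measure.count (fun m => A (m + j)) = luxemburgNorm Φ Measure.count A := by
  simp only [luxemburgNorm, lintegral_count]
  refine iInf_congr fun b => ?_
  have e : ∑' m, Φ (A (m + j) / b) = ∑' m, Φ (A m / b) :=
    (Equiv.addRight j).tsum_eq fun m => Φ (A m / b)
  rw [e]

/-- A Young-type inequality `ℓ¹ * ℓ^Φ ⊆ ℓ^Φ`: Minkowski for the finite measure with density `u`,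
whose slices are translates of `A` and so share one norm. -/
theorem luxemburgNorm_count_tsum_le (hΦ : IsYoungFunction Φ) {G : Type*} [AddGroup G] [Countable G]
    [MeasurableSpace G] [MeasurableSingletonClass G] {u : G → ℝ≥0∞} (hu : ∑' j, u j ≠ ∞)
    (A : G → ℝ≥0∞) :
    luxemburgNorm Φ Measure.count (fun m => ∑' j, u j * A (m + j)) ≤
      (∑' j, u j) * luxemburgNorm Φ Measure.count A := by
  set ρ : Measure G := Measure.count.withDensity u with hρ
  have hint : ∀ f : G → ℝ≥0∞, ∫⁻ j, f j ∂ρ = ∑' j, u j * f j := fun f => by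
    rw [hρ, lintegral_withDensity_eq_lintegral_mul _ (measurable_of_countable u)
      (measurable_of_countable f), lintegral_count]
    rfl
  have : IsFiniteMeasure ρ := ⟨by simpa using (hint 1).trans_lt (by simpa using hu.lt_top)⟩
  have h := luxemburgNorm_lintegral_le (μ := Measure.count) (ρ := ρ) hΦ
    (F := fun m j => A (m + j)) (measurable_of_countable _)
  simpa only [hint, luxemburgNorm_count_add_right, ENNReal.tsum_mul_right] using h

/-- Jensen with `θ = 1/2` gives `Φ (½ ∫ F / b) ≤ 1 < Φ x`, and monotonicity yields `∫ F ≤ 2 x b`. -/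
theorem exists_lintegral_le_luxemburgNorm (hΦ : IsYoungFunction Φ) [IsProbabilityMeasure μ] :
    ∃ C : ℝ≥0, ∀ F : α → ℝ≥0∞, Measurable F → ∫⁻ x, F x ∂μ ≤ C * luxemburgNorm Φ μ F := by
  obtain ⟨x, hx⟩ := hΦ.exists_lt ENNReal.one_lt_top
  have hx0 : x ≠ 0 := by
    rintro rfl
    simp [hΦ.map_zero] at hx
  refine ⟨2 * x, fun F hF => ?_⟩
  have hC0 : ((2 * x : ℝ≥0) : ℝ≥0∞) ≠ 0 := by simpa using hx0
  rw [mul_comm, ← ENNReal.div_le_iff hC0 ENNReal.coe_ne_top]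
  refine le_of_forall_gt_imp_ge_of_dense fun a ha => ?_
  obtain ⟨b, hb, hba⟩ := ENNReal.lt_iff_exists_nnreal_btwn.1 ha
  have hb0 : b ≠ 0 := by rintro rfl; simp at hb
  refine le_trans ?_ hba.le
  have h := (hΦ.map_mul_lintegral_le (μ := μ) (θ := 2⁻¹) prob_le_one (hF.div_const (b : ℝ≥0∞))
    (by norm_num)).trans (lintegral_le_one_of_luxemburgNorm_lt hΦ hb)
  have h2 := (hΦ.monotone.reflect_lt (h.trans_lt hx)).le
  simp only [div_eq_mul_inv] at h2
  rw [lintegral_mul_const _ hF, ← div_eq_mul_inv, ENNReal.coe_inv two_ne_zero, mul_comm,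
    ← div_eq_mul_inv, ENNReal.div_le_iff (by simp) (by simp),
    ENNReal.div_le_iff (by simpa using hb0) (by simp)] at h2
  rw [ENNReal.div_le_iff hC0 ENNReal.coe_ne_top]
  refine h2.trans (le_of_eq ?_)
  push_cast
  ring

/-- Each atom has mass one, so `Φ (F x / b) ≤ 1 < Φ y` and hence `F x ≤ y b`. -/
theorem exists_le_luxemburgNorm_count (hΦ : IsYoungFunction Φ) [MeasurableSingletonClass α] :
    ∃ C : ℝ≥0, ∀ (F : α → ℝ≥0∞) (x : α), F x ≤ C * luxemburgNorm Φ Measure.count F := by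
  obtain ⟨y, hy⟩ := hΦ.exists_lt ENNReal.one_lt_top
  have hy0 : y ≠ 0 := by
    rintro rfl
    simp [hΦ.map_zero] at hy
  have hy0' : (y : ℝ≥0∞) ≠ 0 := by simpa using hy0
  refine ⟨y, fun F x => ?_⟩
  rw [mul_comm, ← ENNReal.div_le_iff hy0' ENNReal.coe_ne_top]
  refine le_of_forall_gt_imp_ge_of_dense fun b hb => ?_
  have h : Φ (F x / b) ≤ 1 := by
    refine le_trans ?_ (lintegral_le_one_of_luxemburgNorm_lt hΦ hb)
    calc Φ (F x / b) = ∫⁻ z in {x}, Φ (F z / b) ∂Measure.count := by simp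
      _ ≤ _ := setLIntegral_le_lintegral _ _
  have h2 := (hΦ.monotone.reflect_lt (h.trans_lt hy)).le
  rw [ENNReal.div_le_iff hy0' ENNReal.coe_ne_top]
  rcases eq_or_ne b ∞ with rfl | hbt
  · simp [hy0']
  rwa [ENNReal.div_le_iff (zero_le.trans_lt hb).ne' hbt, mul_comm] at h2

/-- Continuity at `0` provides `t > 0` with `Φ t < 1`, so the constant `1` has norm at most `1 / t`.
If `Φ` were infinite off `0`, non-zero constants would have infinite norm. -/
theorem exists_luxemburgNorm_const_le (hΦ : IsYoungFunction Φ) (hc : Continuous Φ)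
    [IsProbabilityMeasure μ] :
    ∃ C : ℝ≥0, ∀ c : ℝ≥0∞, luxemburgNorm Φ μ (fun _ => c) ≤ C * c := by
  have h0 : Tendsto (fun t : ℝ≥0 => Φ t) (𝓝[>] 0) (𝓝 0) := by
    have h : Continuous fun t : ℝ≥0 => Φ t := hc.comp ENNReal.continuous_coe
    simpa [hΦ.map_zero] using (h.tendsto 0).mono_left nhdsWithin_le_nhds
  obtain ⟨t, ht, ht0⟩ := ((h0.eventually (gt_mem_nhds zero_lt_one)).and
    self_mem_nhdsWithin).exists
  have ht0' : 0 < t := ht0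
  have hcoe : ∀ c : ℝ≥0, luxemburgNorm Φ μ (fun _ => (c : ℝ≥0∞)) ≤ ↑(t⁻¹) * c := fun c => by
    have h := luxemburgNorm_const_mul_le (μ := μ) hΦ c fun _ => 1
    simp only [mul_one] at h
    rw [mul_comm]
    refine h.trans (mul_le_mul_right (luxemburgNorm_le (inv_pos.2 ht0') ?_) _)
    simpa [ENNReal.coe_inv ht0'.ne'] using ht.le
  refine ⟨t⁻¹, fun c => ?_⟩
  induction c with
  | top => simp [ht0'.ne', ENNReal.mul_top]
  | coe c => exact hcoe c

end Luxemburg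

/-! ### Norms on functions on `ℤⁿ × 𝕋ⁿ` -/

instance (n : ℕ) : IsProbabilityMeasure (torusMeasure n) :=
  inferInstanceAs (IsProbabilityMeasure (Measure.pi fun _ => AddCircle.haarAddCircle))

/-- The properties of a norm on functions on `ℤⁿ × 𝕋ⁿ` which make the associated modulation space
a Banach space independent of the window: the norm is a solid function norm, and on functions of
`m ∈ ℤⁿ` alone it is comparable with the norm of `ℓ^Φ(ℤⁿ)`. -/
structure IsAdmissibleNorm {n : ℕ} (Φ : ℝ≥0∞ → ℝ≥0∞)
    (N : ((Fin n → ℤ) → UnitAddTorus (Fin n) → ℝ≥0∞) → ℝ≥0∞) : Prop where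
  mono : ∀ {F G}, (∀ m w, F m w ≤ G m w) → N F ≤ N G
  add_le : ∀ {F G}, (∀ m, Measurable (F m)) → (∀ m, Measurable (G m)) →
    N (fun m w => F m w + G m w) ≤ N F + N G
  const_mul_le : ∀ (c : ℝ≥0) (F), N (fun m w => c * F m w) ≤ c * N F
  lintegral_le : ∃ C : ℝ≥0, ∀ F, (∀ m, Measurable (F m)) →
    luxemburgNorm Φ Measure.count (fun m => ∫⁻ w, F m w ∂torusMeasure n) ≤ C * N F
  le_count : ∃ C : ℝ≥0, ∀ B : (Fin n → ℤ) → ℝ≥0∞,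
    N (fun m _ => B m) ≤ C * luxemburgNorm Φ Measure.count B

section Instances

variable {n : ℕ}

theorem measurable_uncurry_of_forall {F : (Fin n → ℤ) → UnitAddTorus (Fin n) → ℝ≥0∞}
    (hF : ∀ m, Measurable (F m)) : Measurable (Function.uncurry F) :=
  measurable_from_prod_countable_right hF

theorem isAdmissibleNorm_orlicz {Φ : ℝ≥0∞ → ℝ≥0∞} (hΦ : IsYoungFunction Φ) :
    IsAdmissibleNorm (n := n) Φ fun F =>
      luxemburgNorm Φ (Measure.count.prod (torusMeasure n)) fun p => F p.1 p.2 where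
  mono h := luxemburgNorm_mono hΦ fun p => h p.1 p.2
  add_le hF hG := luxemburgNorm_add_le hΦ (measurable_uncurry_of_forall hF)
    (measurable_uncurry_of_forall hG)
  const_mul_le c F := luxemburgNorm_const_mul_le hΦ c _
  lintegral_le := by
    -- The factor `2` pays for `θ = 1/2` in Jensen's inequality, applied in `w` for each fixed `m`.
    refine ⟨2, fun F hF => ?_⟩
    rw [mul_comm, ← ENNReal.div_le_iff (by simp) (by simp)]
    refine le_of_forall_gt_imp_ge_of_dense fun a ha => ?_
    obtain ⟨b, hb, hba⟩ := ENNReal.lt_iff_exists_nnreal_btwn.1 ha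
    have hb0 : 0 < b := by exact_mod_cast zero_le.trans_lt hb
    refine le_trans ?_ hba.le
    rw [ENNReal.div_le_iff (by simp) (by simp)]
    have hFm := measurable_uncurry_of_forall hF
    refine (luxemburgNorm_le (b := b * 2) (by positivity) ?_).trans_eq (by push_cast; rfl)
    have hm : Measurable fun p : (Fin n → ℤ) × UnitAddTorus (Fin n) => Φ (F p.1 p.2 / b) :=
      hΦ.measurable.comp (hFm.div_const _)
    refine le_trans ?_ (lintegral_le_one_of_luxemburgNorm_lt hΦ hb)
    rw [lintegral_prod _ hm.aemeasurable]
    refine lintegral_mono fun m => ?_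
    refine le_trans (le_of_eq ?_) (hΦ.map_mul_lintegral_le (θ := 2⁻¹) prob_le_one
      ((hF m).div_const (b : ℝ≥0∞)) (by norm_num))
    congr 1
    simp only [div_eq_mul_inv]
    rw [lintegral_mul_const _ (hF m), ENNReal.coe_mul, ENNReal.mul_inv (by simp) (by simp),
      ENNReal.coe_inv two_ne_zero]
    push_cast
    ring
  le_count := by
    refine ⟨1, fun B => ?_⟩
    rw [ENNReal.coe_one, one_mul]
    refine luxemburgNorm_le_of_forall_lt fun b hb => ?_
    refine le_trans (le_of_eq ?_) (lintegral_le_one_of_luxemburgNorm_lt hΦ hb)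
    have hm : Measurable fun p : (Fin n → ℤ) × UnitAddTorus (Fin n) => Φ (B p.1 / b) :=
      (measurable_of_countable fun m => Φ (B m / b)).comp measurable_fst
    rw [lintegral_prod _ hm.aemeasurable]
    simp

theorem isAdmissibleNorm_mixed {Φ₁ Φ₂ : ℝ≥0∞ → ℝ≥0∞} (h₁ : IsYoungFunction Φ₁)
    (h₂ : IsYoungFunction Φ₂) (hc : Continuous Φ₂) :
    IsAdmissibleNorm (n := n) Φ₁ fun F =>
      luxemburgNorm Φ₂ (torusMeasure n) fun w =>
        luxemburgNorm Φ₁ Measure.count fun m => F m w where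
  mono h := luxemburgNorm_mono h₂ fun w => luxemburgNorm_mono h₁ fun m => h m w
  add_le hF hG := by
    refine le_trans (luxemburgNorm_mono h₂ fun w => luxemburgNorm_add_le h₁
      (measurable_of_countable _) (measurable_of_countable _)) ?_
    exact luxemburgNorm_add_le h₂ (measurable_luxemburgNorm h₁ (measurable_uncurry_of_forall hF))
      (measurable_luxemburgNorm h₁ (measurable_uncurry_of_forall hG))
  const_mul_le c F :=
    (luxemburgNorm_mono h₂ fun w => luxemburgNorm_const_mul_le h₁ c _).trans
      (luxemburgNorm_const_mul_le h₂ c _)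
  lintegral_le := by
    obtain ⟨C, hC⟩ := exists_lintegral_le_luxemburgNorm (μ := torusMeasure n) h₂
    refine ⟨C, fun F hF => ?_⟩
    have hFm := measurable_uncurry_of_forall hF
    -- Minkowski moves the torus integral outside the `ℓ^{Φ₁}` norm; then `L^{Φ₂}` embeds in `L¹` on
    -- a probability space.
    exact (luxemburgNorm_lintegral_le h₁ hFm).trans (hC _ (measurable_luxemburgNorm h₁ hFm))
  le_count := by
    obtain ⟨C, hC⟩ := exists_luxemburgNorm_const_le (μ := torusMeasure n) h₂ hc
    exact ⟨C, fun B => hC _⟩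

end Instances

/-! ### Summability on the lattice -/

theorem summable_one_add_abs_int_inv_sq : Summable fun k : ℤ => ((1 + |(k : ℝ)|) ^ 2)⁻¹ := by
  have h : Summable fun k : ℕ => ((1 + (k : ℝ)) ^ 2)⁻¹ := by
    simpa [add_comm] using (summable_nat_add_iff 1).2 (Real.summable_nat_pow_inv.2 one_lt_two)
  exact Summable.of_nat_of_neg (by simpa using h) (by simpa using h)

theorem summable_prod_one_add_abs_int_inv_sq (n : ℕ) :
    Summable fun k : Fin n → ℤ => ∏ i, ((1 + |(k i : ℝ)|) ^ 2)⁻¹ := by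
  induction n with
  | zero => exact Summable.of_finite
  | succ n ih =>
    rw [← (Fin.consEquiv fun _ : Fin (n + 1) => ℤ).summable_iff]
    have h := summable_one_add_abs_int_inv_sq.mul_of_nonneg ih (fun _ => by positivity)
      (fun _ => Finset.prod_nonneg fun _ _ => by positivity)
    refine h.congr fun p => ?_
    simp [Fin.prod_univ_succ, Fin.consEquiv, mul_comm]

/-- The exponent `2 * n` allots a square to each coordinate: `∏ᵢ (1 + |kᵢ|)² ≤ (1 + ‖k‖)^(2n)`. -/
theorem summable_one_add_norm_inv_pow (n : ℕ) :
    Summable fun k : Fin n → ℤ => ((1 + ‖k‖) ^ (2 * n))⁻¹ := by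
  refine Summable.of_nonneg_of_le (fun _ => by positivity) (fun k => ?_)
    (summable_prod_one_add_abs_int_inv_sq n)
  rw [Finset.prod_inv_distrib, pow_mul]
  have h0 : 0 < ∏ i, (1 + |(k i : ℝ)|) ^ 2 := Finset.prod_pos fun _ _ => by positivity
  refine inv_anti₀ h0 ?_
  calc ∏ i, (1 + |(k i : ℝ)|) ^ 2 ≤ ∏ _i : Fin n, (1 + ‖k‖) ^ 2 := by
        refine Finset.prod_le_prod (fun _ _ => by positivity) fun i _ => ?_
        gcongr
        simpa [Int.norm_eq_abs] using norm_le_pi_norm k i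
    _ = _ := by simp

namespace SchwartzZ

variable {n : ℕ}

theorem withSeminorms (n : ℕ) : WithSeminorms (seminorm n) := ⟨rfl⟩

@[ext] theorem ext {g h : SchwartzZ n} (H : ∀ k, g k = h k) : g = h := Subtype.ext (funext H)

theorem le_seminorm (g : SchwartzZ n) (j : ℕ) (k : Fin n → ℤ) :
    (1 + ‖k‖) ^ j * ‖g k‖ ≤ seminorm n j g := le_ciSup (g.bddAbove_weighted j) k

theorem seminorm_le (g : SchwartzZ n) (j : ℕ) {C : ℝ} (h : ∀ k, (1 + ‖k‖) ^ j * ‖g k‖ ≤ C) :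
    seminorm n j g ≤ C := ciSup_le h

theorem norm_apply_le (g : SchwartzZ n) (k : Fin n → ℤ) :
    ‖g k‖ ≤ ((1 + ‖k‖) ^ (2 * n))⁻¹ * seminorm n (2 * n) g := by
  rw [← div_eq_inv_mul, le_div_iff₀ (by positivity), mul_comm]
  exact g.le_seminorm _ k

theorem summable_norm (g : SchwartzZ n) : Summable fun k => ‖g k‖ :=
  Summable.of_nonneg_of_le (fun _ => norm_nonneg _) g.norm_apply_le
    ((summable_one_add_norm_inv_pow n).mul_right _)

/-- The function which is `1` at `k` and `0` elsewhere. -/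
def delta (k : Fin n → ℤ) : SchwartzZ n :=
  ⟨Pi.single k 1, fun j => ⟨(1 + ‖k‖) ^ j, fun l => by
    rcases eq_or_ne l k with rfl | h
    · simp
    · simp [Pi.single_eq_of_ne h]; positivity⟩⟩

theorem delta_apply (k l : Fin n → ℤ) : delta k l = if l = k then 1 else 0 := by
  simp [delta, Pi.single_apply]

theorem sum_apply {ι : Type*} (s : Finset ι) (g : ι → SchwartzZ n) (k : Fin n → ℤ) :
    (∑ i ∈ s, g i) k = ∑ i ∈ s, g i k := by
  have h : (∑ i ∈ s, g i).1 = ∑ i ∈ s, (g i).1 :=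
    map_sum (rapidlyDecreasing n).subtype _ _
  rw [h, Finset.sum_apply]

/-- The finitely supported functions are dense in the Schwartz space: a Schwartz function is the
sum of its values. -/
theorem hasSum_delta (g : SchwartzZ n) : HasSum (fun k => g k • delta k) g := by
  classical
  rw [HasSum, SummationFilter.unconditional_filter, (withSeminorms n).tendsto_nhds]
  intro j ε hε
  -- One extra power of decay makes the tail small: outside the ball of radius `R` the weighted
  -- values are at most `p_{j+1}(g) / R`.
  obtain ⟨R, hR⟩ : ∃ R : ℝ, seminorm n (j + 1) g / R < ε / 2 ∧ 0 < R := by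
    have h := tendsto_const_nhds (x := seminorm n (j + 1) g) |>.div_atTop tendsto_id
    exact ((h.eventually (gt_mem_nhds (half_pos hε))).and (eventually_gt_atTop 0)).exists
  have hfin : {k : Fin n → ℤ | ‖k‖ < R}.Finite := by
    have := (isCompact_closedBall (0 : Fin n → ℤ) R).finite_of_discrete
    exact this.subset fun k hk => by simpa using le_of_lt hk
  filter_upwards [eventually_ge_atTop hfin.toFinset] with s hs
  have key : ∀ k, (∑ i ∈ s, g i • delta i - g) k = if k ∈ s then 0 else - g k := by
    intro k
    change (∑ i ∈ s, g i • delta i) k - g k = _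
    rw [sum_apply]
    change ∑ i ∈ s, g i * delta i k - g k = _
    simp only [delta_apply, mul_ite, mul_one, mul_zero, Finset.sum_ite_eq]
    split_ifs <;> simp
  refine lt_of_le_of_lt (seminorm_le _ _ fun k => ?_) (half_lt_self hε)
  rw [key]
  split_ifs with hk
  · simp; positivity
  · have hkR : R ≤ ‖k‖ := by
      by_contra! h
      exact hk (hs (by simpa using h))
    refine le_trans ?_ hR.1.le
    rw [le_div_iff₀ hR.2, norm_neg]
    refine le_trans ?_ (g.le_seminorm (j + 1) k)
    rw [pow_succ]
    calc (1 + ‖k‖) ^ j * ‖g k‖ * R ≤ (1 + ‖k‖) ^ j * ‖g k‖ * (1 + ‖k‖) := by gcongr; linarith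
      _ = _ := by ring

end SchwartzZ

namespace TemperedZ

open SchwartzZ

variable {n : ℕ}

/-- A tempered distribution on `ℤⁿ` is given by its values at the points. -/
theorem hasSum (f : TemperedZ n) (g : SchwartzZ n) :
    HasSum (fun k => g k * f (delta k)) (f g) := by
  simpa using ContinuousLinearMap.hasSum f g.hasSum_delta

theorem ext_delta {f₁ f₂ : TemperedZ n} (h : ∀ k, f₁ (delta k) = f₂ (delta k)) : f₁ = f₂ := by
  ext g
  refine (f₁.hasSum g).unique ?_
  simpa only [h] using f₂.hasSum g

/-- The tempered distribution of a bounded function. -/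
theorem exists_of_bounded (a : (Fin n → ℤ) → ℂ) {C : ℝ} (ha : ∀ k, ‖a k‖ ≤ C) :
    ∃ f : TemperedZ n, ∀ k, f (delta k) = a k := by
  have hb : ∀ (g : SchwartzZ n) k, ‖g k * a k‖ ≤
      ((1 + ‖k‖) ^ (2 * n))⁻¹ * seminorm n (2 * n) g * C := fun g k => by
    rw [norm_mul]
    exact mul_le_mul (g.norm_apply_le k) (ha k) (norm_nonneg _)
      (mul_nonneg (by positivity) (apply_nonneg _ _))
  have hS : ∀ g : SchwartzZ n,
      Summable fun k : Fin n → ℤ => ((1 + ‖k‖) ^ (2 * n))⁻¹ * seminorm n (2 * n) g * C :=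
    fun g => ((summable_one_add_norm_inv_pow n).mul_right _).mul_right _
  have hs : ∀ g : SchwartzZ n, Summable fun k => g k * a k := fun g =>
    Summable.of_norm_bounded (hS g) (hb g)
  let L : SchwartzZ n →ₗ[ℂ] ℂ :=
    { toFun := fun g => ∑' k, g k * a k
      map_add' := fun g h => by
        rw [← (hs g).tsum_add (hs h)]
        exact tsum_congr fun k => add_mul _ _ _
      map_smul' := fun c g => by
        rw [RingHom.id_apply, smul_eq_mul, ← tsum_mul_left]
        exact tsum_congr fun k => mul_assoc _ _ _ }
  have hL : Continuous L := by
    have hC : 0 ≤ C := (norm_nonneg _).trans (ha 0)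
    refine (withSeminorms n).continuous_normedSpace_rng ℂ L
      ⟨{2 * n}, ⟨(∑' k : Fin n → ℤ, ((1 + ‖k‖) ^ (2 * n))⁻¹) * C,
        mul_nonneg (tsum_nonneg fun _ => by positivity) hC⟩, fun g => ?_⟩
    have h := tsum_of_norm_bounded (hS g).hasSum (hb g)
    rw [tsum_mul_right, tsum_mul_right] at h
    refine h.trans (le_of_eq ?_)
    rw [Finset.sup_singleton]
    change _ = (∑' k : Fin n → ℤ, ((1 + ‖k‖) ^ (2 * n))⁻¹) * C * seminorm n (2 * n) g
    ring
  refine ⟨⟨L, hL⟩, fun k => ?_⟩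
  change ∑' l, delta k l * a l = a k
  simp [delta_apply]

end TemperedZ

/-! ### Fourier series on the torus -/

section Fourier

open UnitAddTorus

variable {n : ℕ}

theorem norm_mFourier_apply (k : Fin n → ℤ) (w : UnitAddTorus (Fin n)) :
    ‖mFourier k w‖ = 1 := by
  simp only [mFourier, fourier_apply, ContinuousMap.coe_mk, norm_prod, Circle.norm_coe,
    Finset.prod_const_one]

theorem integral_fourier_haarAddCircle (i : ℤ) :
    ∫ x : UnitAddCircle, fourier i x ∂AddCircle.haarAddCircle = if i = 0 then (1 : ℂ) else 0 := by
  split_ifs with h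
  · simp [h]
  -- A suitable translation changes the sign of a non-trivial character, so its invariant integral
  -- vanishes.
  · exact integral_eq_zero_of_add_right_eq_neg (fourier_add_half_inv_index h one_pos)

theorem integral_mFourier (k : Fin n → ℤ) :
    ∫ w, mFourier k w ∂torusMeasure n = if k = 0 then (1 : ℂ) else 0 := by
  have h := integral_fintype_prod_eq_prod (𝕜 := ℂ)
    (μ := fun _ : Fin n => (AddCircle.haarAddCircle : Measure UnitAddCircle))
    (fun i x => fourier (k i) x)
  refine h.trans ?_
  simp only [integral_fourier_haarAddCircle, Finset.prod_ite_zero, Finset.prod_const_one]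
  simp [funext_iff]

/-- The coefficients of an absolutely convergent Fourier series are bounded by the integral of the
absolute value of its sum. -/
theorem enorm_le_lintegral_of_hasSum_mFourier {c : (Fin n → ℤ) → ℂ} (hc : Summable fun k => ‖c k‖)
    {S : UnitAddTorus (Fin n) → ℂ} (hS : ∀ w, HasSum (fun k => c k * mFourier (-k) w) (S w))
    (k : Fin n → ℤ) : ‖c k‖ₑ ≤ ∫⁻ w, ‖S w‖ₑ ∂torusMeasure n := by
  -- After multiplication by the character of index `k`, orthogonality kills every term but one;
  -- absolute convergence justifies termwise integration.
  have hint : ∀ j, ∫ w, c j * mFourier (-j + k) w ∂torusMeasure n = if j = k then c k else 0 := by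
    intro j
    rw [integral_const_mul, integral_mFourier]
    by_cases h : j = k
    · simp [h]
    · have : -j + k ≠ 0 := fun e => h (neg_add_eq_zero.1 e)
      simp [h, this]
  have hsum := hasSum_integral_of_summable_integral_norm (μ := torusMeasure n)
    (F := fun j w => c j * mFourier (-j + k) w)
    (fun j => Integrable.of_bound (C := ‖c j‖)
      (continuous_const.mul (mFourier (-j + k)).continuous).aestronglyMeasurable
      (Eventually.of_forall fun w => by simp [norm_mFourier_apply]))
    (by simpa [norm_mFourier_apply] using hc)
  simp only [hint] at hsum
  have hval : ∀ w, ∑' j, c j * mFourier (-j + k) w = S w * mFourier k w := fun w => by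
    rw [← (hS w).tsum_eq, ← tsum_mul_right]
    exact tsum_congr fun j => by rw [mFourier_add, mul_assoc]
  simp only [hval] at hsum
  rw [(hasSum_ite_eq k (c k)).unique hsum]
  refine (enorm_integral_le_lintegral_enorm _).trans (le_of_eq ?_)
  refine lintegral_congr fun w => ?_
  rw [enorm_mul, ← ofReal_norm (mFourier k w), norm_mFourier_apply]
  simp

end Fourier

/-! ### The short-time Fourier transform -/

section STFT

open SchwartzZ UnitAddTorus

variable {n : ℕ}

theorem hasSum_stft (g : SchwartzZ n) (f : TemperedZ n) (m : Fin n → ℤ)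
    (w : UnitAddTorus (Fin n)) :
    HasSum (fun k => f (delta k) * conj (g (k - m)) * mFourier (-k) w) (stft g f m w) := by
  refine (TemperedZ.hasSum f (((g.translate m).modulate w).conjugate)).congr_fun fun k => ?_
  change _ = conj (mFourier k w * g (k - m)) * f (delta k)
  rw [mFourier_neg, map_mul]
  ring

/-- At any single `w` the characters are unimodular, and a summable family in `ℂ` is absolutely
summable. -/
theorem summable_norm_stft (g : SchwartzZ n) (f : TemperedZ n) (m : Fin n → ℤ) :
    Summable fun k => ‖f (delta k) * conj (g (k - m))‖ := by
  simpa [norm_mFourier_apply] using (hasSum_stft g f m 0).summable.norm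

theorem continuous_stft (g : SchwartzZ n) (f : TemperedZ n) (m : Fin n → ℤ) :
    Continuous (stft g f m) := by
  have h : stft g f m = fun w => ∑' k, f (delta k) * conj (g (k - m)) * mFourier (-k) w :=
    funext fun w => (hasSum_stft g f m w).tsum_eq.symm
  rw [h]
  refine continuous_tsum (fun k => ?_) (summable_norm_stft g f m) fun k w => ?_
  · exact continuous_const.mul (mFourier (-k)).continuous
  · simp [norm_mFourier_apply]

theorem measurable_enorm_stft (g : SchwartzZ n) (f : TemperedZ n) (m : Fin n → ℤ) :
    Measurable fun w => ‖stft g f m w‖ₑ := (continuous_stft g f m).measurable.enorm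

/-- The values of a tempered distribution are controlled by the short-time Fourier transform. -/
theorem enorm_mul_enorm_le_lintegral_stft (g : SchwartzZ n) (f : TemperedZ n)
    (m k : Fin n → ℤ) :
    ‖f (delta (k + m))‖ₑ * ‖g k‖ₑ ≤ ∫⁻ w, ‖stft g f m w‖ₑ ∂torusMeasure n := by
  have h := enorm_le_lintegral_of_hasSum_mFourier (summable_norm_stft g f m) (hasSum_stft g f m)
    (k + m)
  simpa [enorm_mul] using h

theorem enorm_stft_le (g : SchwartzZ n) (f : TemperedZ n) (m : Fin n → ℤ)
    (w : UnitAddTorus (Fin n)) :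
    ‖stft g f m w‖ₑ ≤ ∑' j, ‖g j‖ₑ * ‖f (delta (m + j))‖ₑ := by
  rw [← (hasSum_stft g f m w).tsum_eq,
    ← (Equiv.addLeft m).tsum_eq fun k => f (delta k) * conj (g (k - m)) * mFourier (-k) w]
  refine enorm_tsum_le_tsum_enorm.trans (le_of_eq (tsum_congr fun j => ?_))
  rw [enorm_mul, enorm_mul, ← ofReal_norm (mFourier _ w), norm_mFourier_apply]
  simp [mul_comm]

theorem stft_add (g : SchwartzZ n) (f₁ f₂ : TemperedZ n) (m : Fin n → ℤ)
    (w : UnitAddTorus (Fin n)) : stft g (f₁ + f₂) m w = stft g f₁ m w + stft g f₂ m w := rfl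

theorem stft_smul (g : SchwartzZ n) (c : ℂ) (f : TemperedZ n) (m : Fin n → ℤ)
    (w : UnitAddTorus (Fin n)) : stft g (c • f) m w = c * stft g f m w := rfl

end STFT

/-! ### Modulation spaces -/

/-- A criterion for `IsBanachSpaceOn` in terms of a norm with values in `[0, ∞]`. -/
theorem isBanachSpaceOn_of_complete {E : Type*} [AddCommGroup E] [Module ℂ E] {N : E → ℝ≥0∞}
    (hadd : ∀ f g, N (f + g) ≤ N f + N g) (hsmul : ∀ (c : ℂ) f, N (c • f) ≤ ‖c‖ₑ * N f)
    (hzero : ∀ f, N f = 0 → f = 0)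
    (hcomp : ∀ u : ℕ → E, (∀ ε : ℝ≥0∞, 0 < ε → ∃ K, ∀ i ≥ K, ∀ j ≥ K, N (u i - u j) < ε) →
      ∃ f, Tendsto (fun i => N (u i - f)) atTop (𝓝 0)) :
    IsBanachSpaceOn {f | N f < ∞} N := by
  have h0 : N 0 = 0 := by simpa using hsmul 0 0
  let M : Submodule ℂ E :=
    { carrier := {f | N f < ∞}
      zero_mem' := by simp [h0]
      add_mem' := fun {f g} hf hg => (hadd f g).trans_lt (ENNReal.add_lt_top.2 ⟨hf, hg⟩)
      smul_mem' := fun c f hf => (hsmul c f).trans_lt (ENNReal.mul_lt_top enorm_lt_top hf) }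
  have hM : ∀ f : M, N f ≠ ∞ := fun f => (show N f < ∞ from f.2).ne
  have hsmul' : ∀ (c : ℂ) f, N (c • f) = ‖c‖ₑ * N f := by
    intro c f
    refine le_antisymm (hsmul c f) ?_
    rcases eq_or_ne c 0 with rfl | hc
    · simp
    -- The reverse inequality is the assumed one for the scalar `c⁻¹`.
    have h := hsmul c⁻¹ (c • f)
    rw [inv_smul_smul₀ hc, enorm_inv hc] at h
    calc ‖c‖ₑ * N f ≤ ‖c‖ₑ * (‖c‖ₑ⁻¹ * N (c • f)) := by gcongr
      _ = N (c • f) := by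
        rw [← mul_assoc, ENNReal.mul_inv_cancel (by simpa using hc) enorm_ne_top, one_mul]
  let : Norm M := ⟨fun f => (N f).toReal⟩
  have core : NormedSpace.Core ℂ M :=
    { norm_nonneg := fun f => ENNReal.toReal_nonneg
      norm_smul := fun c f => by
        change (N (c • (f : E))).toReal = ‖c‖ * (N f).toReal
        rw [hsmul', ENNReal.toReal_mul, toReal_enorm]
      norm_triangle := fun f g => by
        change (N ((f : E) + g)).toReal ≤ (N f).toReal + (N g).toReal
        rw [← ENNReal.toReal_add (hM f) (hM g)]
        exact ENNReal.toReal_mono (ENNReal.add_ne_top.2 ⟨hM f, hM g⟩) (hadd f g)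
      norm_eq_zero_iff := fun f => by
        change (N f).toReal = 0 ↔ f = 0
        rw [ENNReal.toReal_eq_zero_iff, or_iff_left (hM f)]
        exact ⟨fun h => Subtype.ext (hzero f h), fun h => by simp [h, h0]⟩ }
  refine ⟨M, rfl, fun f hf => hf, core, ?_⟩
  let := NormedAddCommGroup.ofCore core
  have hdist : ∀ f g : M, dist f g = (N ((f : E) - g)).toReal := fun f g => dist_eq_norm f g
  refine Metric.complete_of_cauchySeq_tendsto fun u hu => ?_
  obtain ⟨f, hf⟩ := hcomp (fun i => u i) fun ε hε => by
    rcases eq_or_ne ε ∞ with rfl | hεt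
    · exact ⟨0, fun i _ j _ => (hM (u i - u j)).lt_top⟩
    obtain ⟨K, hK⟩ := Metric.cauchySeq_iff.1 hu ε.toReal (ENNReal.toReal_pos hε.ne' hεt)
    refine ⟨K, fun i hi j hj => ?_⟩
    have h := hK i hi j hj
    rw [hdist] at h
    exact (ENNReal.toReal_lt_toReal (hM (u i - u j)) hεt).1 h
  have hfM : N f < ∞ := by
    obtain ⟨i, hi⟩ := (hf.eventually (gt_mem_nhds ENNReal.zero_lt_top)).exists
    have h1 := hadd (u i : E) ((-1 : ℂ) • (u i - f))
    have h2 := hsmul (-1) ((u i : E) - f)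
    rw [neg_one_smul, neg_sub, add_sub_cancel] at h1
    rw [neg_one_smul, neg_sub] at h2
    refine h1.trans_lt (ENNReal.add_lt_top.2 ⟨(hM (u i)).lt_top, h2.trans_lt ?_⟩)
    exact ENNReal.mul_lt_top enorm_lt_top hi
  refine ⟨⟨f, hfM⟩, tendsto_iff_dist_tendsto_zero.2 ?_⟩
  simp only [hdist]
  exact (ENNReal.tendsto_toReal ENNReal.zero_ne_top).comp hf

namespace IsAdmissibleNorm

open SchwartzZ

variable {n : ℕ} {Φ : ℝ≥0∞ → ℝ≥0∞}
  {N : ((Fin n → ℤ) → UnitAddTorus (Fin n) → ℝ≥0∞) → ℝ≥0∞}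

/-- At a point `k` where the window does not vanish, `|f(l)|` is at most `1 / |g k|` times the torus
average of `V_g f(l - k, ·)`; the shift by `k` does not affect the `ℓ^Φ` norm. -/
theorem exists_luxemburgNorm_le (hN : IsAdmissibleNorm Φ N) (hΦ : IsYoungFunction Φ)
    {g : SchwartzZ n} (hg : g ≠ 0) :
    ∃ C : ℝ≥0, ∀ f : TemperedZ n, luxemburgNorm Φ Measure.count (fun k => ‖f (delta k)‖ₑ) ≤
      C * N fun m w => ‖stft g f m w‖ₑ := by
  obtain ⟨k, hk⟩ : ∃ k, g k ≠ 0 := by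
    by_contra! h
    exact hg (SchwartzZ.ext h)
  obtain ⟨C, hC⟩ := hN.lintegral_le
  refine ⟨‖g k‖₊⁻¹ * C, fun f => ?_⟩
  set A : (Fin n → ℤ) → ℝ≥0∞ := fun m => ∫⁻ w, ‖stft g f m w‖ₑ ∂torusMeasure n with hA
  have hpt : ∀ l, ‖f (delta l)‖ₑ ≤ (‖g k‖₊⁻¹ : ℝ≥0) * A (l + -k) := fun l => by
    have h := enorm_mul_enorm_le_lintegral_stft g f (l + -k) k
    rw [add_comm l, add_neg_cancel_left, add_comm (-k)] at h
    rw [ENNReal.coe_inv (by simpa using hk), mul_comm, ← div_eq_mul_inv,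
      ENNReal.le_div_iff_mul_le (.inl (by simpa using hk)) (.inl ENNReal.coe_ne_top)]
    exact h
  calc luxemburgNorm Φ Measure.count (fun k => ‖f (delta k)‖ₑ)
      ≤ luxemburgNorm Φ Measure.count fun l => (‖g k‖₊⁻¹ : ℝ≥0) * A (l + -k) :=
        luxemburgNorm_mono hΦ hpt
    _ ≤ (‖g k‖₊⁻¹ : ℝ≥0) * luxemburgNorm Φ Measure.count fun l => A (l + -k) :=
        luxemburgNorm_const_mul_le hΦ _ _
    _ = (‖g k‖₊⁻¹ : ℝ≥0) * luxemburgNorm Φ Measure.count A := by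
        rw [luxemburgNorm_count_add_right]
    _ ≤ (‖g k‖₊⁻¹ : ℝ≥0) * (C * N fun m w => ‖stft g f m w‖ₑ) := by
        gcongr
        exact hC _ (measurable_enorm_stft g f)
    _ = _ := by rw [ENNReal.coe_mul, mul_assoc]

theorem exists_le_luxemburgNorm (hN : IsAdmissibleNorm Φ N) (hΦ : IsYoungFunction Φ)
    (g : SchwartzZ n) :
    ∃ C : ℝ≥0, ∀ f : TemperedZ n, N (fun m w => ‖stft g f m w‖ₑ) ≤
      C * luxemburgNorm Φ Measure.count (fun k => ‖f (delta k)‖ₑ) := by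
  obtain ⟨C, hC⟩ := hN.le_count
  have hg : ∑' j, ‖g j‖ₑ ≠ ∞ := by
    have h := g.summable_norm.tsum_ofReal_ne_top
    simpa only [ofReal_norm] using h
  refine ⟨C * (∑' j, ‖g j‖ₑ).toNNReal, fun f => ?_⟩
  rw [ENNReal.coe_mul, ENNReal.coe_toNNReal hg, mul_assoc]
  refine (hN.mono (enorm_stft_le g f)).trans ((hC _).trans ?_)
  gcongr
  exact luxemburgNorm_count_tsum_le hΦ hg fun k => ‖f (delta k)‖ₑ

theorem exists_le_of_window (hN : IsAdmissibleNorm Φ N) (hΦ : IsYoungFunction Φ)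
    (g : SchwartzZ n) {h : SchwartzZ n} (hh : h ≠ 0) :
    ∃ C : ℝ≥0, ∀ f : TemperedZ n,
      N (fun m w => ‖stft g f m w‖ₑ) ≤ C * N (fun m w => ‖stft h f m w‖ₑ) := by
  obtain ⟨A, hA⟩ := hN.exists_le_luxemburgNorm hΦ g
  obtain ⟨B, hB⟩ := hN.exists_luxemburgNorm_le hΦ hh
  refine ⟨A * B, fun f => (hA f).trans ?_⟩
  rw [ENNReal.coe_mul, mul_assoc]
  gcongr
  exact hB f

theorem window_independent (hN : IsAdmissibleNorm Φ N) (hΦ : IsYoungFunction Φ)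
    {g h : SchwartzZ n} (hg : g ≠ 0) (hh : h ≠ 0) :
    {f : TemperedZ n | N (fun m w => ‖stft g f m w‖ₑ) < ∞} =
      {f : TemperedZ n | N (fun m w => ‖stft h f m w‖ₑ) < ∞} ∧
    EquivalentNormsOn {f : TemperedZ n | N (fun m w => ‖stft g f m w‖ₑ) < ∞}
      (fun f => N fun m w => ‖stft g f m w‖ₑ) (fun f => N fun m w => ‖stft h f m w‖ₑ) := by
  obtain ⟨A, hA⟩ := hN.exists_le_of_window hΦ g hh
  obtain ⟨B, hB⟩ := hN.exists_le_of_window hΦ h hg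
  refine ⟨Set.ext fun f => ⟨fun hf => ?_, fun hf => ?_⟩, A, B, fun f _ => ⟨hA f, hB f⟩⟩
  · exact (hB f).trans_lt (ENNReal.mul_lt_top ENNReal.coe_lt_top hf)
  · exact (hA f).trans_lt (ENNReal.mul_lt_top ENNReal.coe_lt_top hf)

theorem isBanachSpaceOn (hN : IsAdmissibleNorm Φ N) (hΦ : IsYoungFunction Φ)
    {g : SchwartzZ n} (hg : g ≠ 0) :
    IsBanachSpaceOn {f : TemperedZ n | N (fun m w => ‖stft g f m w‖ₑ) < ∞}
      fun f => N fun m w => ‖stft g f m w‖ₑ := by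
  obtain ⟨A, hA⟩ := hN.exists_luxemburgNorm_le hΦ hg
  obtain ⟨B, hB⟩ := hN.exists_le_luxemburgNorm hΦ g
  obtain ⟨C, hC⟩ := exists_le_luxemburgNorm_count (α := Fin n → ℤ) hΦ
  have hpt : ∀ (f : TemperedZ n) k,
      ‖f (delta k)‖ₑ ≤ (C * A : ℝ≥0) * N fun m w => ‖stft g f m w‖ₑ := fun f k => by
    rw [ENNReal.coe_mul, mul_assoc]
    exact (hC (fun k => ‖f (delta k)‖ₑ) k).trans (by gcongr; exact hA f)
  refine isBanachSpaceOn_of_complete (fun f₁ f₂ => ?_) (fun c f => ?_) (fun f hf => ?_)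
    fun u hu => ?_
  · refine le_trans (hN.mono fun m w => ?_)
      (hN.add_le (measurable_enorm_stft g f₁) (measurable_enorm_stft g f₂))
    rw [stft_add]
    exact enorm_add_le _ _
  · refine le_trans (hN.mono fun m w => ?_) (hN.const_mul_le ‖c‖₊ _)
    rw [stft_smul, enorm_mul]
    rfl
  · refine TemperedZ.ext_delta fun k => ?_
    simpa [hf] using hpt f k
  have hsmall : ∀ (D : ℝ≥0) (ε : ℝ≥0∞), 0 < ε → ∃ K, ∀ i ≥ K, ∀ j ≥ K,
      D * N (fun m w => ‖stft g (u i - u j) m w‖ₑ) ≤ ε := by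
    intro D ε hε
    obtain ⟨K, hK⟩ := hu (ε / D) (ENNReal.div_pos hε.ne' ENNReal.coe_ne_top)
    refine ⟨K, fun i hi j hj => ?_⟩
    rw [mul_comm]
    exact ENNReal.mul_le_of_le_div (hK i hi j hj).le
  have hptsmall : ∀ ε : ℝ≥0∞, 0 < ε → ∃ K, ∀ i ≥ K, ∀ j ≥ K, ∀ k,
      ‖u i (delta k) - u j (delta k)‖ₑ ≤ ε := fun ε hε => by
    obtain ⟨K, hK⟩ := hsmall (C * A) ε hε
    exact ⟨K, fun i hi j hj k => (hpt (u i - u j) k).trans (hK i hi j hj)⟩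
  have hlim : ∀ k, ∃ a, Tendsto (fun i => u i (delta k)) atTop (𝓝 a) := fun k => by
    refine cauchySeq_tendsto_of_complete (EMetric.cauchySeq_iff.2 fun ε hε => ?_)
    obtain ⟨δ, hδ, hδε⟩ := exists_between hε
    obtain ⟨K, hK⟩ := hptsmall δ hδ
    exact ⟨K, fun i hi j hj => by
      rw [edist_eq_enorm_sub]; exact (hK i hi j hj k).trans_lt hδε⟩
  choose a ha using hlim
  -- The pointwise limit `a` need not be bounded, but it lies within `1` of the values of `u K₁`.
  -- The bounded difference defines a tempered distribution, to which `u K₁` is added back.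
  obtain ⟨K₁, hK₁⟩ := hptsmall 1 one_pos
  obtain ⟨d, hd⟩ := TemperedZ.exists_of_bounded (fun k => a k - u K₁ (delta k)) (C := 1)
    fun k => by
      refine le_of_tendsto ((ha k).sub_const _).norm ?_
      filter_upwards [eventually_ge_atTop K₁] with i hi
      have h := hK₁ i hi K₁ le_rfl k
      rwa [← ofReal_norm, ENNReal.ofReal_le_one] at h
  set f := d + u K₁ with hf
  have hfa : ∀ k, Tendsto (fun l => u l (delta k)) atTop (𝓝 (f (delta k))) := fun k => by
    have e : f (delta k) = a k := by
      change d (delta k) + u K₁ (delta k) = a k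
      rw [hd, sub_add_cancel]
    rw [e]
    exact ha k
  refine ⟨f, ENNReal.tendsto_atTop_zero.2 fun ε hε => ?_⟩
  -- The factor `B * A` accounts for passing to `ℓ^Φ`, where Fatou's lemma is applied in `l`, and
  -- back to the modulation norm.
  obtain ⟨K, hK⟩ := hsmall (B * A) ε hε
  refine ⟨K, fun i hi => (hB _).trans ?_⟩
  have hlim' : ∀ k, liminf (fun l => ‖(u i - u l) (delta k)‖ₑ) atTop = ‖(u i - f) (delta k)‖ₑ :=
    fun k => (((hfa k).const_sub (u i (delta k))).enorm).liminf_eq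
  have hfatou := luxemburgNorm_liminf_le (μ := Measure.count) hΦ
    (F := fun l k => ‖(u i - u l) (delta k)‖ₑ) fun l => measurable_of_countable _
  simp only [hlim'] at hfatou
  have hB' : (B : ℝ≥0∞) * liminf (fun l => luxemburgNorm Φ Measure.count
      fun k => ‖(u i - u l) (delta k)‖ₑ) atTop ≤ ε := by
    rw [← ENNReal.liminf_const_mul_of_ne_top ENNReal.coe_ne_top]
    refine liminf_le_of_frequently_le (Eventually.frequently ?_) (by isBoundedDefault)
    filter_upwards [eventually_ge_atTop K] with l hl
    refine le_trans ?_ (hK i hi l hl)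
    rw [ENNReal.coe_mul, mul_assoc]
    gcongr
    exact hA _
  exact (mul_le_mul_right hfatou _).trans hB'

end IsAdmissibleNorm

end

theorem mainTheorem12 (n : ℕ) :
    (∀ Φ : ℝ≥0∞ → ℝ≥0∞, IsYoungFunction Φ → LocalDeltaTwo Φ →
      Continuous (complementaryFunction Φ) →
        (∀ g h : SchwartzZ n, g ≠ 0 → h ≠ 0 →
          modulationSpace Φ g = modulationSpace Φ h ∧
          EquivalentNormsOn (modulationSpace Φ g) (modulationNorm Φ g) (modulationNorm Φ h)) ∧
        ∀ g : SchwartzZ n, g ≠ 0 →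
          IsBanachSpaceOn (modulationSpace Φ g) (modulationNorm Φ g)) ∧
    (∀ Φ₁ Ψ₁ Φ₂ Ψ₂ : ℝ≥0∞ → ℝ≥0∞,
      IsComplementaryYoungPair Φ₁ Ψ₁ → IsComplementaryYoungPair Φ₂ Ψ₂ →
      LocalDeltaTwo Φ₁ → LocalDeltaTwo Φ₂ →
      IsStrictlyConvex Φ₁ → IsStrictlyConvex Φ₂ →
      Continuous Φ₁ → Continuous Φ₂ →
        (∀ g h : SchwartzZ n, g ≠ 0 → h ≠ 0 →
          mixedModulationSpace Φ₁ Φ₂ g = mixedModulationSpace Φ₁ Φ₂ h ∧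
          EquivalentNormsOn (mixedModulationSpace Φ₁ Φ₂ g)
            (mixedModulationNorm Φ₁ Φ₂ g) (mixedModulationNorm Φ₁ Φ₂ h)) ∧
        ∀ g : SchwartzZ n, g ≠ 0 →
          IsBanachSpaceOn (mixedModulationSpace Φ₁ Φ₂ g) (mixedModulationNorm Φ₁ Φ₂ g)) := by
  
  refine ⟨fun Φ hΦ _ _ => ?_, fun Φ₁ _ Φ₂ _ h₁ h₂ _ _ _ _ _ hc => ?_⟩
  · have hN := isAdmissibleNorm_orlicz (n := n) hΦ
    exact ⟨fun g h hg hh => hN.window_independent hΦ hg hh, fun g hg => hN.isBanachSpaceOn hΦ hg⟩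
  · have hN := isAdmissibleNorm_mixed (n := n) h₁.left h₂.left hc
    exact ⟨fun g h hg hh => hN.window_independent h₁.left hg hh,
      fun g hg => hN.isBanachSpaceOn h₁.left hg⟩
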